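/- **Setting.** Let $(X,d)$ be a metric space, let $f_n:X\to X$ $(n\ge 0)$ be maps, and consider the non-autonomous system $x_{n+1}=f_n(x_n)$, $n\ge0$. Put $f_0^0=\mathrm{id}$ and $f_0^n=f_{n-1}\circ\cdots\circ f_0$. For nonempty $B,C\subset X$ let $d(B,C)=\inf\{d(b,c):b\in B,\ c\in C\}$. Let $A=(a_{ij})$ be an $N\times N$ transition matrix, i.e. $N\ge2$, all $a_{ij}\in\{0,1\}$, and every row and every column of $A$ contains a $1$. $A$ is irreducible if for all $i,j$ there is $k\ge1$ with $(A^k)_{ij}>0$. Let $\|A\|=\sum_{i,j}a_{ij}$ and $\rho(A)=\lim_{n\to\infty}\|A^n\|^{1/n}$. Let $\Sigma_N^+(A)=\{(s_0,s_1,\dots): 1\le s_j\le N,\ a_{s_js_{j+1}}=1 \text{ for all } j\ge 0\}$, with the metric $\hat\rho(\alpha,\beta)=\sum_{i\ge0}2^{-i}\hat d(\alpha_i,\beta_i)$, where $\hat d(a,b)=0$ if $a=b$ and $\hat d(a,b)=1$ otherwise, and let $\sigma_A(s_0,s_1,\dots)=(s_1,s_2,\dots)$. **Theorem 3.7.** Let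 $V_1,\dots,V_N$ be nonempty bounded subsets of $X$ with $d(V_i,V_j)>0$ for $i\ne j$, and let $V_{i,n}\subset V_i$ $(1\le i\le N,\ n\ge0)$ be nonempty compact sets. Put $E=\bigcup_{n\ge0}\bigcup_{i=1}^N V_{i,n}$ and assume: * (equi-continuity on $E$) for every $\epsilon>0$ there is $\delta>0$ such that $d(f_n(x),f_n(y))<\epsilon$ for all $n\ge0$ and all $x,y\in E$ with $d(x,y)<\delta$; * (weak $A$-coupled-expansion) $V_{i,n}\cap V_{j,n}=\partial V_{i,n}\cap\partial V_{j,n}$ for all $n\ge 0$ and $i\ne j$, and $f_n(V_{i,n})\supset\bigcup_{j:\,a_{ij}=1}V_{j,n+1}$ for all $i$ and all $n\ge 0$; * (uniform expansion) there is $\lambda>1$ with $d(f_n(x),f_n(y))\ge\lambda\, d(x,y)$ for all $x,y\in V_{i,n}$, all $i$ and all $n\ge 0$. Then there are nonempty compact sets $\Lambda_n\subset\bigcup_{i=1}^N V_{i,n}$ $(n\ge0)$ with $f_n(\Lambda_n)=\Lambda_{n+1}$ for all $n$ such that: 1. The system restricted to $\{\Lambda_n\}$ is topologically equi-conjugate to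 $(\Sigma_N^+(A),\sigma_A)$: there are bijections $h_n:\Lambda_n\to\Sigma_N^+(A)$ with $h_{n+1}\circ f_n=\sigma_A\circ h_n$ on $\Lambda_n$ such that $(h_n)_{n\ge0}$ and $(h_n^{-1})_{n\ge0}$ are equi-continuous (for every $\epsilon>0$ one $\delta>0$ serves all $n$ and all pairs of points). 2. If $X$ is compact, then $h(f_{0,\infty},\Lambda_0)=\log\rho(A)$. Here, for nonempty $Y\subset X$, $$h(f_{0,\infty},Y)=\sup_{\mathcal A}\ \limsup_{n\to\infty}\frac1n\log\mathcal N(\mathcal A_0^n|_Y),$$ where the supremum is over all open covers $\mathcal A$ of $X$, $\mathcal A_0^n=\{\bigcap_{j=0}^{n-1}(f_0^j)^{-1}(U_j):U_j\in\mathcal A\}$, $\mathcal A_0^n|_Y=\{B\cap Y:B\in\mathcal A_0^n\}$, and $\mathcal N(\mathcal A_0^n|_Y)$ is the least cardinality of a subfamily of $\mathcal A_0^n|_Y$ that covers $Y$. If moreover $A$ is irreducible and $\sum_{j=1}^N a_{i_0j}\ge2$ for some $i_0$, then the system is * Li–Yorke $\delta$-chaotic for some $\delta>0$: there is an uncountable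 set $S\subset X$ with $\liminf_{n\to\infty} d(f_0^n(x),f_0^n(y))=0$ and $\limsup_{n\to\infty} d(f_0^n(x),f_0^n(y))>\delta$ for all distinct $x,y\in S$; * distributionally chaotic: there is an uncountable set $D\subset X$ such that for all distinct $x,y\in D$ one has $\limsup_{n\to\infty} F_n(\epsilon)=1$ for every $\epsilon>0$ and $\liminf_{n\to\infty} F_n(\delta)=0$ for some $\delta>0$, where $F_n(\epsilon)=\frac1n\#\{0\le i<n: d(f_0^i(x),f_0^i(y))<\epsilon\}$; * chaotic in the strong sense of Li–Yorke: for some $\delta>0$ there is a set $S$ as in the first item all of whose points have bounded orbits $\{f_0^n(x):n\ge0\}$. -/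

import Mathlib

open Filter Topology Set

/-! Non-autonomous discrete systems `x_{n+1} = f_n (x_n)`, given by a sequence `f : ℕ → X → X`. -/

namespace NDS

noncomputable section

/-! ### Transition matrices -/

/-- An `N × N` transition matrix (`N ≥ 2`): a `0`-`1` matrix without zero rows or zero columns. -/
structure IsTransitionMatrix {N : ℕ} (A : Matrix (Fin N) (Fin N) ℕ) : Prop where
  two_le : 2 ≤ N
  zero_or_one : ∀ i j, A i j = 0 ∨ A i j = 1
  row : ∀ i, 1 ≤ ∑ j, A i j
  col : ∀ j, 1 ≤ ∑ i, A i j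

/-- Irreducibility: every entry is positive in some positive power of `A`. -/
def IsIrreducible {N : ℕ} (A : Matrix (Fin N) (Fin N) ℕ) : Prop :=
  ∀ i j, ∃ k : ℕ, 1 ≤ k ∧ 0 < (A ^ k) i j

/-- `‖A‖`, the sum of all entries. -/
def entrySum {N : ℕ} (A : Matrix (Fin N) (Fin N) ℕ) : ℝ := ((∑ i, ∑ j, A i j : ℕ) : ℝ)

/-- `ρ(A) = lim ‖A ^ n‖ ^ (1 / n)`. The limit exists, see `tendsto_rho`. -/
def rho {N : ℕ} (A : Matrix (Fin N) (Fin N) ℕ) : ℝ :=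
  limUnder atTop (fun n : ℕ => entrySum (A ^ n) ^ (1 / (n : ℝ)))

lemma entrySum_mul_le {N : ℕ} (A B : Matrix (Fin N) (Fin N) ℕ) :
    entrySum (A * B) ≤ entrySum A * entrySum B := by
  unfold entrySum
  rw [← Nat.cast_mul, Nat.cast_le]
  calc ∑ i, ∑ j, (A * B) i j = ∑ i, ∑ k, A i k * ∑ j, B k j := by
        refine Finset.sum_congr rfl fun i _ => ?_
        simp only [Matrix.mul_apply]
        rw [Finset.sum_comm]
        simp only [Finset.mul_sum]
    _ ≤ ∑ i, ∑ k, A i k * ∑ k', ∑ j, B k' j := by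
        refine Finset.sum_le_sum fun i _ => Finset.sum_le_sum fun k _ =>
          Nat.mul_le_mul_left _ ?_
        exact Finset.single_le_sum (f := fun k' => ∑ j, B k' j) (fun _ _ => Nat.zero_le _)
          (Finset.mem_univ k)
    _ = (∑ i, ∑ k, A i k) * ∑ k', ∑ j, B k' j := by
        simp only [Finset.sum_mul]

lemma one_le_entrySum_pow {N : ℕ} {A : Matrix (Fin N) (Fin N) ℕ} (hA : IsTransitionMatrix A)
    (n : ℕ) : 1 ≤ entrySum (A ^ n) := by
  have hrow : ∀ n : ℕ, ∀ i, 1 ≤ ∑ j, (A ^ n) i j := by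
    intro n
    induction n with
    | zero => intro i; simp [Matrix.one_apply]
    | succ k ih =>
      intro i
      have h : ∑ j, (A ^ (k + 1)) i j = ∑ l, A i l * ∑ j, (A ^ k) l j := by
        simp only [pow_succ', Matrix.mul_apply]
        rw [Finset.sum_comm]
        simp only [Finset.mul_sum]
      rw [h]
      calc 1 ≤ ∑ l, A i l * 1 := by simpa using hA.row i
        _ ≤ _ := by gcongr with l _; exact ih l
  unfold entrySum
  have i0 : Fin N := ⟨0, by have := hA.two_le; omega⟩
  have : 1 ≤ ∑ i, ∑ j, (A ^ n) i j :=
    (hrow n i0).trans (Finset.single_le_sum (f := fun i => ∑ j, (A ^ n) i j)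
      (fun _ _ => Nat.zero_le _) (Finset.mem_univ i0))
  exact_mod_cast this

/-- The limit that defines `rho` exists. -/
lemma tendsto_rho {N : ℕ} {A : Matrix (Fin N) (Fin N) ℕ} (hA : IsTransitionMatrix A) :
    Tendsto (fun n : ℕ => entrySum (A ^ n) ^ (1 / (n : ℝ))) atTop (𝓝 (rho A)) := by
  have hpos : ∀ n, 0 < entrySum (A ^ n) := fun n =>
    lt_of_lt_of_le one_pos (one_le_entrySum_pow hA n)
  have hsub : Subadditive (fun n : ℕ => Real.log (entrySum (A ^ n))) := by
    intro m n
    rw [← Real.log_mul (hpos m).ne' (hpos n).ne']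
    refine Real.log_le_log (hpos _) ?_
    rw [pow_add]
    exact entrySum_mul_le _ _
  have hbdd : BddBelow (range fun n : ℕ => Real.log (entrySum (A ^ n)) / n) := by
    refine ⟨0, ?_⟩
    rintro _ ⟨n, rfl⟩
    exact div_nonneg (Real.log_nonneg (one_le_entrySum_pow hA n)) (Nat.cast_nonneg n)
  have h := (Real.continuous_exp.tendsto _).comp (hsub.tendsto_lim hbdd)
  refine tendsto_nhds_limUnder ⟨_, h.congr fun n => ?_⟩
  rw [Function.comp_apply, Real.rpow_def_of_pos (hpos n), mul_one_div]

/-! ### One-sided subshifts of finite type -/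

/-- `Σ_N^+(A)`: the sequences `s` with `a_{s_j s_{j+1}} = 1` for all `j`. -/
def Subshift {N : ℕ} (A : Matrix (Fin N) (Fin N) ℕ) : Type :=
  {s : ℕ → Fin N // ∀ j, A (s j) (s (j + 1)) = 1}

/-- The metric `∑ i, d̂ (a_i, b_i) / 2 ^ i` with the discrete metric `d̂` on symbols. -/
def symDist {N : ℕ} (a b : ℕ → Fin N) : ℝ :=
  ∑' i : ℕ, (if a i = b i then (0 : ℝ) else 1) / 2 ^ i

lemma symDist_summable {N : ℕ} (a b : ℕ → Fin N) :
    Summable (fun i : ℕ => (if a i = b i then (0 : ℝ) else 1) / 2 ^ i) := by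
  refine Summable.of_nonneg_of_le (fun i => ?_) (fun i => ?_) summable_geometric_two
  · split_ifs <;> positivity
  · rw [one_div, inv_pow, ← one_div]
    gcongr
    split_ifs <;> norm_num

instance {N : ℕ} (A : Matrix (Fin N) (Fin N) ℕ) : MetricSpace (Subshift A) where
  dist a b := symDist a.1 b.1
  dist_self a := by simp [symDist]
  dist_comm a b := by simp only [symDist, eq_comm]
  dist_triangle a b c := by
    unfold symDist
    rw [← (symDist_summable a.1 b.1).tsum_add (symDist_summable b.1 c.1)]
    refine (symDist_summable a.1 c.1).tsum_le_tsum (fun i => ?_)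
      ((symDist_summable a.1 b.1).add (symDist_summable b.1 c.1))
    rw [← add_div]
    gcongr
    by_cases h1 : a.1 i = b.1 i <;> by_cases h2 : b.1 i = c.1 i
    · simp [h1, h2]
    · simp [h1, h2]
    · simp [← h2, h1]
    · simp only [h1, h2, if_false]
      split_ifs <;> norm_num
  eq_of_dist_eq_zero := by
    intro a b h
    refine Subtype.ext (funext fun i => ?_)
    have h0 : ∀ i : ℕ, 0 ≤ (if a.1 i = b.1 i then (0 : ℝ) else 1) / 2 ^ i := fun i => by
      split_ifs <;> positivity
    have h1 := (symDist_summable a.1 b.1).le_tsum i (fun j _ => h0 j)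
    have h2 : (if a.1 i = b.1 i then (0 : ℝ) else 1) / 2 ^ i ≤ 0 := h1.trans (le_of_eq h)
    by_contra hne
    rw [if_neg hne] at h2
    have : (0 : ℝ) < 1 / 2 ^ i := by positivity
    linarith

/-- The shift map `σ_A`. -/
def shift {N : ℕ} (A : Matrix (Fin N) (Fin N) ℕ) (s : Subshift A) : Subshift A :=
  ⟨fun j => s.1 (j + 1), fun j => s.2 (j + 1)⟩

/-! ### Systems, equi-continuity and equi-conjugacy -/

/-- `f_0^n = f_{n-1} ∘ ⋯ ∘ f_0`, with `f_0^0 = id`. -/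
def iter {X : Type*} (f : ℕ → X → X) : ℕ → X → X
  | 0 => id
  | n + 1 => f n ∘ iter f n

/-- Equi-continuity of a sequence of maps between metric spaces `S n → T n`:
one `δ` for all `n` and all points. -/
def EquiCont {S T : ℕ → Type*} [∀ n, PseudoMetricSpace (S n)] [∀ n, PseudoMetricSpace (T n)]
    (h : ∀ n, S n → T n) : Prop :=
  ∀ ε > 0, ∃ δ > 0, ∀ n, ∀ x y : S n, dist x y < δ → dist (h n x) (h n y) < ε

/-- The sequence of sets `Λ n` is invariant: `f_n (Λ_n) ⊆ Λ_{n+1}`. -/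
def Invariant {X : Type*} (f : ℕ → X → X) (Λ : ℕ → Set X) : Prop :=
  ∀ n, MapsTo (f n) (Λ n) (Λ (n + 1))

/-- Topological equi-conjugacy of the invariant subsystems of `f` on `Λ` and of `g` on `E`:
bijections `h_n : Λ_n → E_n` with `h_{n+1} ∘ f_n = g_n ∘ h_n`, such that both `(h_n)` and
`(h_n⁻¹)` are equi-continuous. -/
def EquiConjugate {X Y : Type*} [MetricSpace X] [MetricSpace Y]
    (f : ℕ → X → X) (Λ : ℕ → Set X) (g : ℕ → Y → Y) (E : ℕ → Set Y) : Prop :=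
  ∃ (hΛ : Invariant f Λ) (_ : Invariant g E) (h : ∀ n, Λ n ≃ E n),
    (∀ n (x : Λ n), (h (n + 1) ⟨f n x, hΛ n x.2⟩ : Y) = g n (h n x)) ∧
    EquiCont (fun n => (h n : Λ n → E n)) ∧
    EquiCont (fun n => ((h n).symm : E n → Λ n))

/-- The distance `inf {d (a, b) : a ∈ A, b ∈ B}` of two (nonempty) sets. -/
def setDist {X : Type*} [MetricSpace X] (A B : Set X) : ℝ :=
  sInf {r | ∃ a ∈ A, ∃ b ∈ B, r = dist a b}

/-- The system `f` is weakly `A`-coupled-expanding in the sets `V i n`. -/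
structure WeaklyCoupledExpanding {X : Type*} [MetricSpace X] {N : ℕ} (f : ℕ → X → X)
    (A : Matrix (Fin N) (Fin N) ℕ) (V : Fin N → ℕ → Set X) : Prop where
  nonempty : ∀ i n, (V i n).Nonempty
  inter_eq : ∀ i j n, i ≠ j → V i n ∩ V j n = frontier (V i n) ∩ frontier (V j n)
  expand : ∀ i n, (⋃ (j) (_ : A i j = 1), V j (n + 1)) ⊆ f n '' V i n

/-! ### Topological entropy through open covers -/

/-- `𝒜_0^n`, the family of all `⋂_{j < n} (f_0^j)⁻¹ (U_j)` with `U_j ∈ 𝒜`. -/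
def iterCover {X : Type*} (f : ℕ → X → X) (𝒜 : Set (Set X)) (n : ℕ) : Set (Set X) :=
  {B | ∃ U : Fin n → Set X, (∀ j, U j ∈ 𝒜) ∧ B = ⋂ j : Fin n, iter f j ⁻¹' U j}

/-- `𝒩(ℬ)` for a family `ℬ` that covers `Y`: the least number of members of `ℬ` that cover `Y`.
(In the compact case, where it is used, finite subcovers exist.) -/
def minCard {X : Type*} (ℬ : Set (Set X)) (Y : Set X) : ℕ :=
  sInf {k | ∃ s : Finset (Set X), (s : Set (Set X)) ⊆ ℬ ∧ Y ⊆ ⋃₀ (s : Set (Set X)) ∧ s.card = k}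

/-- The topological entropy `h (f_{0,∞}, Y)` of the system on a nonempty subset `Y` of the compact
space `X`: the supremum over all open covers `𝒜` of `X` of
`limsup (1 / n) log 𝒩(𝒜_0^n |_Y)`. -/
def entropy {X : Type*} [MetricSpace X] [CompactSpace X] (f : ℕ → X → X) (Y : Set X) : EReal :=
  ⨆ (𝒜 : Set (Set X)) (_ : (∀ U ∈ 𝒜, IsOpen U) ∧ ⋃₀ 𝒜 = univ),
    limsup (fun n : ℕ =>
      ((Real.log (minCard ((fun B => B ∩ Y) '' iterCover f 𝒜 n) Y) / n : ℝ) : EReal)) atTop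

/-! ### Chaos -/

/-- `S` is Li–Yorke `δ`-scrambled; `edist` keeps the upper limit meaningful along unbounded
orbits. -/
def LiYorkeScrambled {X : Type*} [MetricSpace X] (f : ℕ → X → X) (δ : ℝ) (S : Set X) : Prop :=
  ∀ x ∈ S, ∀ y ∈ S, x ≠ y →
    liminf (fun n => edist (iter f n x) (iter f n y)) atTop = 0 ∧
    ENNReal.ofReal δ < limsup (fun n => edist (iter f n x) (iter f n y)) atTop

/-- Li–Yorke `δ`-chaos: there is an uncountable Li–Yorke `δ`-scrambled set. -/
def LiYorkeChaotic {X : Type*} [MetricSpace X] (f : ℕ → X → X) (δ : ℝ) : Prop :=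
  ∃ S : Set X, ¬ S.Countable ∧ LiYorkeScrambled f δ S

/-- Chaos in the strong sense of Li–Yorke: for some `δ > 0` there is an uncountable Li–Yorke
`δ`-scrambled set all of whose points have bounded orbits. -/
def StronglyLiYorkeChaotic {X : Type*} [MetricSpace X] (f : ℕ → X → X) : Prop :=
  ∃ δ : ℝ, 0 < δ ∧ ∃ S : Set X, ¬ S.Countable ∧ LiYorkeScrambled f δ S ∧
    ∀ x ∈ S, Bornology.IsBounded (range fun n => iter f n x)

/-- `(1 / n) ∑_{i < n} χ_{[0, ε)} (d (f_0^i x, f_0^i y))`. -/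
def closeFreq {X : Type*} [MetricSpace X] (f : ℕ → X → X) (x y : X) (ε : ℝ) (n : ℕ) : ℝ :=
  (1 / (n : ℝ)) * ∑ i ∈ Finset.range n,
    (Ico (0 : ℝ) ε).indicator (fun _ => (1 : ℝ)) (dist (iter f i x) (iter f i y))

/-- Distributional chaos: there is an uncountable distributionally scrambled set. -/
def DistributionallyChaotic {X : Type*} [MetricSpace X] (f : ℕ → X → X) : Prop :=
  ∃ D : Set X, ¬ D.Countable ∧ ∀ x ∈ D, ∀ y ∈ D, x ≠ y →
    (∀ ε : ℝ, 0 < ε → limsup (closeFreq f x y ε) atTop = 1) ∧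
    (∃ δ : ℝ, 0 < δ ∧ liminf (closeFreq f x y δ) atTop = 0)

end

end NDS

/-! Symbolic coding. For a sequence `s` in the subshift and a time `n`, the points of `W (s 0) n`
that follow `s` for `m` more steps form a decreasing sequence of compact sets. The covering relation
makes them nonempty, and expansion bounds their diameters by `D * lam⁻¹ ^ m`. They shrink to one
point `G n s`, and `f n (G n s) = G (n + 1) (shift A s)` (`exists_coding`). The sets sought are `Λ n
= range (G n)`.

Two estimates, uniform in `n`, carry everything else. Itineraries with a long common prefix give
close points, by expansion (`dist_coding_le`). Close points have itineraries with a long common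
prefix, by equi-continuity and the positive distances between the `V i` (`exists_separation`).
Equi-conjugacy is a restatement of the two.

Entropy: the least cardinality of a subcover is compared with numbers of words, and there are `‖A ^
n‖` words of length `n + 1` (`ncard_range_word`).

Chaos: irreducibility and a branching vertex give two loops of equal length that can be concatenated
freely, so arbitrary bit sequences are encoded in the subshift. Bits are held constant on intervals
so long that each dwarfs its entire past. Any two encoded points are then close along almost all of
some intervals and apart along almost all of others, infinitely often each. -/

namespace NDS

/-! ### Coding of orbits by itineraries. -/

section Coding

variable {X : Type*} {N : ℕ} {A : Matrix (Fin N) (Fin N) ℕ}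

/-- The points of `W (s 0) n` whose orbit follows the itinerary `s` for `m` further steps. -/
def itinerarySet (f : ℕ → X → X) (W : Fin N → ℕ → Set X) : ℕ → ℕ → Subshift A → Set X
  | 0, n, s => W (s.1 0) n
  | m + 1, n, s => W (s.1 0) n ∩ f n ⁻¹' itinerarySet f W m (n + 1) (shift A s)

variable {f : ℕ → X → X} {W : Fin N → ℕ → Set X}

lemma itinerarySet_subset (m n : ℕ) (s : Subshift A) :
    itinerarySet f W m n s ⊆ W (s.1 0) n := by
  cases m with
  | zero => exact Subset.rfl
  | succ m => exact inter_subset_left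

lemma itinerarySet_succ_subset (m : ℕ) : ∀ (n : ℕ) (s : Subshift A),
    itinerarySet f W (m + 1) n s ⊆ itinerarySet f W m n s := by
  induction m with
  | zero => exact fun n s => inter_subset_left
  | succ m ih => exact fun n s => inter_subset_inter_right _ (preimage_mono (ih _ _))

/-- A point that follows the shifted itinerary starts in `W (s 1) (n + 1)`, which `f n '' W (s 0) n`
covers, so it can be pulled back one step. -/
lemma itinerarySet_nonempty (hne : ∀ i n, (W i n).Nonempty)
    (hexp : ∀ i n, (⋃ (j) (_ : A i j = 1), W j (n + 1)) ⊆ f n '' W i n) (m : ℕ) :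
    ∀ (n : ℕ) (s : Subshift A), (itinerarySet f W m n s).Nonempty := by
  induction m with
  | zero => exact fun n s => hne _ _
  | succ m ih =>
    intro n s
    obtain ⟨y, hy⟩ := ih (n + 1) (shift A s)
    have hy' : y ∈ W (s.1 1) (n + 1) := itinerarySet_subset _ _ _ hy
    obtain ⟨x, hx, rfl⟩ := hexp (s.1 0) n (mem_iUnion₂.2 ⟨s.1 1, s.2 0, hy'⟩)
    exact ⟨x, hx, hy⟩

lemma iterate_shift_apply (k : ℕ) : ∀ (s : Subshift A) (i : ℕ),
    ((shift A)^[k] s).1 i = s.1 (k + i) := by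
  induction k with
  | zero => simp
  | succ k ih =>
    intro s i
    rw [Function.iterate_succ_apply, ih]
    show s.1 (k + i + 1) = _
    rw [Nat.add_right_comm]

lemma iter_coding {G : ℕ → Subshift A → X}
    (hstep : ∀ n s, f n (G n s) = G (n + 1) (shift A s)) (s : Subshift A) (k : ℕ) :
    iter f k (G 0 s) = G k ((shift A)^[k] s) := by
  induction k with
  | zero => rfl
  | succ k ih => rw [Function.iterate_succ_apply', ← hstep, ← ih]; rfl

variable [MetricSpace X]

/-- Since `f n` is continuous only on the closed sets `W i n`, the preimage is closed after
intersection with `W i n`. -/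
lemma itinerarySet_isCompact (hcpt : ∀ i n, IsCompact (W i n))
    (hcont : ∀ i n, ContinuousOn (f n) (W i n)) (m : ℕ) :
    ∀ (n : ℕ) (s : Subshift A), IsCompact (itinerarySet f W m n s) := by
  induction m with
  | zero => exact fun n s => hcpt _ _
  | succ m ih =>
    exact fun n s => (hcpt _ _).of_isClosed_subset
      ((hcont _ _).preimage_isClosed_of_isClosed (hcpt _ _).isClosed (ih _ _).isClosed)
      inter_subset_left

lemma dist_le_of_mem_itinerarySet {lam D : ℝ} (hlam : 1 < lam)
    (hexpand : ∀ i n, ∀ x ∈ W i n, ∀ y ∈ W i n, lam * dist x y ≤ dist (f n x) (f n y))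
    (hD : ∀ i n, ∀ x ∈ W i n, ∀ j, ∀ y ∈ W j n, dist x y ≤ D) (m : ℕ) :
    ∀ (n : ℕ) (s : Subshift A), ∀ x ∈ itinerarySet f W m n s, ∀ y ∈ itinerarySet f W m n s,
      dist x y ≤ D * (lam⁻¹) ^ m := by
  have h0 : 0 < lam := by linarith
  induction m with
  | zero => intro n s x hx y hy; simpa using hD _ _ x hx _ y hy
  | succ m ih =>
    rintro n s x ⟨hx, hx'⟩ y ⟨hy, hy'⟩
    have h1 := hexpand _ _ x hx y hy
    have h2 := ih _ _ _ hx' _ hy'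
    rw [pow_succ, ← mul_assoc, ← div_eq_mul_inv, le_div_iff₀ h0]
    linarith

lemma tendsto_mul_inv_pow {lam : ℝ} (hlam : 1 < lam) (D : ℝ) :
    Tendsto (fun m : ℕ => D * (lam⁻¹) ^ m) atTop (𝓝 0) := by
  have := (tendsto_pow_atTop_nhds_zero_of_lt_one (inv_nonneg.2 (by linarith : (0:ℝ) ≤ lam))
    (inv_lt_one_of_one_lt₀ hlam)).const_mul D
  simpa using this

/-- Every itinerary is realized, by points depending equivariantly on it. -/
lemma exists_coding (hne : ∀ i n, (W i n).Nonempty)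
    (hexp : ∀ i n, (⋃ (j) (_ : A i j = 1), W j (n + 1)) ⊆ f n '' W i n)
    (hcpt : ∀ i n, IsCompact (W i n)) (hcont : ∀ i n, ContinuousOn (f n) (W i n))
    {lam D : ℝ} (hlam : 1 < lam)
    (hexpand : ∀ i n, ∀ x ∈ W i n, ∀ y ∈ W i n, lam * dist x y ≤ dist (f n x) (f n y))
    (hD : ∀ i n, ∀ x ∈ W i n, ∀ j, ∀ y ∈ W j n, dist x y ≤ D) :
    ∃ G : ℕ → Subshift A → X, (∀ n s, G n s ∈ W (s.1 0) n) ∧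
      ∀ n s, f n (G n s) = G (n + 1) (shift A s) := by
  have hex : ∀ n (s : Subshift A), (⋂ m, itinerarySet f W m n s).Nonempty := fun n s =>
    IsCompact.nonempty_iInter_of_sequence_nonempty_isCompact_isClosed _
      (fun m => itinerarySet_succ_subset m n s) (fun m => itinerarySet_nonempty hne hexp m n s)
      (itinerarySet_isCompact hcpt hcont 0 n s)
      (fun m => (itinerarySet_isCompact hcpt hcont m n s).isClosed)
  choose G hG using hex
  have hG' : ∀ n s m, G n s ∈ itinerarySet f W m n s := fun n s m => mem_iInter.1 (hG n s) m
  refine ⟨G, fun n s => hG' n s 0, fun n s => ?_⟩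
  -- Both points lie in every itinerary set of `shift A s`, so they coincide: the choice of `G` was
  -- forced.
  have hle : ∀ m : ℕ, dist (f n (G n s)) (G (n + 1) (shift A s)) ≤ D * (lam⁻¹) ^ m := fun m =>
    dist_le_of_mem_itinerarySet hlam hexpand hD m _ _ _ (hG' n s (m + 1)).2 _ (hG' _ _ m)
  exact dist_le_zero.1 (ge_of_tendsto' (tendsto_mul_inv_pow hlam D) hle)

variable {G : ℕ → Subshift A → X}

lemma dist_coding_le (hmem : ∀ n s, G n s ∈ W (s.1 0) n)
    (hstep : ∀ n s, f n (G n s) = G (n + 1) (shift A s)) {lam D : ℝ} (hlam : 1 < lam)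
    (hexpand : ∀ i n, ∀ x ∈ W i n, ∀ y ∈ W i n, lam * dist x y ≤ dist (f n x) (f n y))
    (hD : ∀ i n, ∀ x ∈ W i n, ∀ j, ∀ y ∈ W j n, dist x y ≤ D) (m : ℕ) :
    ∀ n (s t : Subshift A), (∀ i < m, s.1 i = t.1 i) →
      dist (G n s) (G n t) ≤ D * (lam⁻¹) ^ m := by
  have h0 : 0 < lam := by linarith
  induction m with
  | zero => intro n s t _; simpa using hD _ _ _ (hmem n s) _ _ (hmem n t)
  | succ m ih =>
    intro n s t hst
    have h1 := hexpand _ n _ (hmem n s) (G n t) (by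
      rw [hst 0 (Nat.succ_pos m)]; exact hmem n t)
    rw [hstep, hstep] at h1
    have h2 := ih (n + 1) (shift A s) (shift A t) (fun i hi => hst (i + 1) (by omega))
    rw [pow_succ, ← mul_assoc, ← div_eq_mul_inv, le_div_iff₀ h0]
    linarith

/-- Nearby coded points have itineraries with a long common prefix, uniformly in time. -/
lemma exists_separation (hmem : ∀ n s, G n s ∈ W (s.1 0) n)
    (hstep : ∀ n s, f n (G n s) = G (n + 1) (shift A s))
    (hequi : ∀ ε > 0, ∃ δ > 0, ∀ n, ∀ x ∈ ⋃ (m) (i), W i m, ∀ y ∈ ⋃ (m) (i), W i m,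
      dist x y < δ → dist (f n x) (f n y) < ε)
    {δ₀ : ℝ} (hδ₀ : 0 < δ₀)
    (hsep : ∀ i j n, ∀ x ∈ W i n, ∀ y ∈ W j n, dist x y < δ₀ → i = j) (m : ℕ) :
    ∃ δ > 0, ∀ n (s t : Subshift A), dist (G n s) (G n t) < δ → ∀ i < m, s.1 i = t.1 i := by
  induction m with
  | zero => exact ⟨1, one_pos, by simp⟩
  | succ m ih =>
    obtain ⟨δ, hδ, h⟩ := ih
    obtain ⟨δ', hδ', h'⟩ := hequi δ hδ
    -- `δ₀` decides the first symbol; `δ'` keeps the images close enough for the induction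
    -- hypothesis to decide the others.
    refine ⟨min δ₀ δ', lt_min hδ₀ hδ', fun n s t hst i hi => ?_⟩
    cases i with
    | zero => exact hsep _ _ n _ (hmem n s) _ (hmem n t) (hst.trans_le (min_le_left _ _))
    | succ i =>
      have := h' n _ (mem_iUnion₂.2 ⟨n, _, hmem n s⟩) _ (mem_iUnion₂.2 ⟨n, _, hmem n t⟩)
        (hst.trans_le (min_le_right _ _))
      rw [hstep, hstep] at this
      exact h _ _ _ this i (by omega)

end Coding

/-! ### The subshift: metric, compactness, counting of words. -/

section Subshift

variable {N : ℕ} {A : Matrix (Fin N) (Fin N) ℕ}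

lemma IsTransitionMatrix.exists_succ (hA : IsTransitionMatrix A) (i : Fin N) :
    ∃ j, A i j = 1 := by
  by_contra! h
  have h0 : ∑ j, A i j = 0 :=
    Finset.sum_eq_zero fun j _ => (hA.zero_or_one i j).resolve_right (h j)
  have := hA.row i
  omega

lemma IsTransitionMatrix.exists_pred (hA : IsTransitionMatrix A) (j : Fin N) :
    ∃ i, A i j = 1 := by
  by_contra! h
  have h0 : ∑ i, A i j = 0 :=
    Finset.sum_eq_zero fun i _ => (hA.zero_or_one i j).resolve_right (h i)
  have := hA.col j
  omega

lemma exists_subshift_cons {i : Fin N} (s : Subshift A) (h : A i (s.1 0) = 1) :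
    ∃ t : Subshift A, t.1 0 = i ∧ shift A t = s :=
  ⟨⟨fun k => Nat.casesOn k i s.1, fun k => by cases k; exacts [h, s.2 _]⟩, rfl, rfl⟩

lemma shift_surjective (hA : IsTransitionMatrix A) : Function.Surjective (shift A) := fun s =>
  let ⟨_, hi⟩ := hA.exists_pred (s.1 0)
  let ⟨t, _, ht⟩ := exists_subshift_cons s hi
  ⟨t, ht⟩

lemma exists_subshift_zero (hA : IsTransitionMatrix A) (i : Fin N) :
    ∃ s : Subshift A, s.1 0 = i := by
  choose g hg using hA.exists_succ
  refine ⟨⟨fun k => g^[k] i, fun k => ?_⟩, rfl⟩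
  simp only [Function.iterate_succ_apply']
  exact hg _

lemma subshift_nonempty (hA : IsTransitionMatrix A) : Nonempty (Subshift A) :=
  let ⟨s, _⟩ := exists_subshift_zero hA ⟨0, by have := hA.two_le; omega⟩
  ⟨s⟩

/-- Only the tail from index `m` on contributes, and it sums to at most `2 * (1 / 2) ^ m`. -/
lemma dist_lt_of_agree {ε : ℝ} (hε : 0 < ε) :
    ∃ m : ℕ, ∀ s t : Subshift A, (∀ i < m, s.1 i = t.1 i) → dist s t < ε := by
  obtain ⟨m, hm⟩ := exists_pow_lt_of_lt_one (half_pos hε) (by norm_num : (1 / 2 : ℝ) < 1)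
  refine ⟨m, fun s t hst => ?_⟩
  have hle : symDist s.1 t.1 ≤
      ∑' i : ℕ, (1 / 2 : ℝ) ^ m * (if m ≤ i then (1 / 2 : ℝ) ^ (i - m) else 0) := by
    have hs : Summable fun i : ℕ =>
        (1 / 2 : ℝ) ^ m * (if m ≤ i then (1 / 2 : ℝ) ^ (i - m) else 0) := by
      refine Summable.mul_left _ ?_
      rw [← summable_nat_add_iff m]
      simpa using summable_geometric_two
    refine (symDist_summable _ _).tsum_le_tsum (fun i => ?_) hs
    by_cases hi : m ≤ i
    · rw [if_pos hi, ← pow_add, Nat.add_sub_cancel' hi, one_div, inv_pow, ← one_div]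
      gcongr
      split_ifs <;> norm_num
    · rw [if_neg hi, if_pos (hst i (by omega))]; simp
  have heq : ∑' i : ℕ, (if m ≤ i then (1 / 2 : ℝ) ^ (i - m) else 0) = 2 := by
    have hs : Summable fun i : ℕ => (if m ≤ i then (1 / 2 : ℝ) ^ (i - m) else 0) := by
      rw [← summable_nat_add_iff m]
      simpa using summable_geometric_two
    rw [← hs.sum_add_tsum_nat_add m, Finset.sum_eq_zero (fun i hi => by
      rw [if_neg (by simpa using hi)])]
    simpa using tsum_geometric_two
  rw [tsum_mul_left, heq] at hle
  change symDist s.1 t.1 < ε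
  linarith

lemma agree_of_dist_lt (m : ℕ) :
    ∃ δ > 0, ∀ s t : Subshift A, dist s t < δ → ∀ i < m, s.1 i = t.1 i := by
  refine ⟨1 / 2 ^ m, by positivity, fun s t hst i hi => ?_⟩
  by_contra hne
  have h1 := (symDist_summable s.1 t.1).le_tsum i (fun j _ => by split_ifs <;> positivity)
  rw [if_neg hne] at h1
  have h2 : (1 : ℝ) / 2 ^ m ≤ 1 / 2 ^ i := by
    gcongr
    · norm_num
  exact absurd (h2.trans h1) (not_le.2 hst)

/-- A map on the subshift that is controlled by finite prefixes has compact range. -/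
lemma isCompact_range_of_agree {X : Type*} [MetricSpace X] {g : Subshift A → X}
    (hg : ∀ ε > 0, ∃ m : ℕ, ∀ s t : Subshift A, (∀ i < m, s.1 i = t.1 i) →
      dist (g s) (g t) < ε) : IsCompact (range g) := by
  -- Compactness comes from the product topology on `ℕ → Fin N`, whose cylinders are the prefix
  -- conditions in `hg`.
  let K : Set (ℕ → Fin N) := {s | ∀ j, A (s j) (s (j + 1)) = 1}
  have hK : IsClosed K := by
    have : K = ⋂ j, {s | A (s j) (s (j + 1)) = 1} := by ext; simp [K]
    rw [this]
    refine isClosed_iInter fun j => ?_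
    have hA : Continuous fun p : Fin N × Fin N => A p.1 p.2 := continuous_of_discreteTopology
    have hpair : Continuous fun s : ℕ → Fin N => (s j, s (j + 1)) := by fun_prop
    have hc : Continuous fun s : ℕ → Fin N => A (s j) (s (j + 1)) := hA.comp hpair
    exact isClosed_eq hc continuous_const
  have : CompactSpace K := isCompact_iff_compactSpace.1 hK.isCompact
  let g' : K → X := fun s => g ⟨s.1, s.2⟩
  have hcont : Continuous g' := by
    rw [continuous_iff_continuousAt]
    intro s
    rw [ContinuousAt, Metric.tendsto_nhds]
    intro ε hε
    obtain ⟨m, hm⟩ := hg ε hε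
    have hopen : IsOpen (Subtype.val ⁻¹' PiNat.cylinder s.1 m : Set K) :=
      (PiNat.isOpen_cylinder _ _ _).preimage continuous_subtype_val
    filter_upwards [hopen.mem_nhds (PiNat.self_mem_cylinder s.1 m)] with t ht
    exact hm _ _ (fun i hi => PiNat.mem_cylinder_iff.1 ht i hi)
  have hrange : range g = range g' := Subset.antisymm
    (range_subset_iff.2 fun s => ⟨⟨s.1, s.2⟩, rfl⟩) (range_subset_iff.2 fun s => ⟨⟨s.1, s.2⟩, rfl⟩)
  rw [hrange]
  exact isCompact_range hcont

/-- The prefix of length `n` of a point of the subshift. -/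
def word (n : ℕ) (s : Subshift A) : Fin n → Fin N := fun j => s.1 j

/-- No row of `A` vanishes, so an admissible word never gets stuck on the right. -/
lemma exists_word_eq (hA : IsTransitionMatrix A) (n : ℕ) : ∀ w : Fin (n + 1) → Fin N,
    (∀ k : Fin n, A (w k.castSucc) (w k.succ) = 1) → ∃ s : Subshift A, word (n + 1) s = w := by
  induction n with
  | zero =>
    intro w _
    obtain ⟨s, hs⟩ := exists_subshift_zero hA (w 0)
    exact ⟨s, funext fun j => by rw [Fin.fin_one_eq_zero j]; exact hs⟩
  | succ n ih =>
    intro w hw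
    obtain ⟨s, hs⟩ := ih (fun k => w k.succ) (fun k => by simpa using hw k.succ)
    have h0 : s.1 0 = w 1 := congrFun hs 0
    obtain ⟨t, ht, hts⟩ := exists_subshift_cons (i := w 0) s (by rw [h0]; exact hw 0)
    refine ⟨t, funext fun j => ?_⟩
    induction j using Fin.cases with
    | zero => exact ht
    | succ j =>
      rw [← congrFun hs j, ← hts]
      rfl

/-- The weight `u` on the first vertex serves the induction: summing that vertex out leaves a
shorter path with weight `∑ a, u a * A a b`. With `u = 1` the sum counts paths with `n` edges. -/
lemma sum_prod_path (n : ℕ) : ∀ u : Fin N → ℕ,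
    ∑ w : Fin (n + 1) → Fin N, u (w 0) * ∏ k : Fin n, A (w k.castSucc) (w k.succ) =
      ∑ i, u i * ∑ j, (A ^ n) i j := by
  induction n with
  | zero =>
    intro u
    rw [← (Equiv.funUnique (Fin 1) (Fin N)).symm.sum_comp]
    simp [Matrix.one_apply]
  | succ n ih =>
    intro u
    have h1 := ih (fun b => ∑ a, u a * A a b)
    rw [← (Fin.consEquiv fun _ : Fin (n + 2) => Fin N).sum_comp, Fintype.sum_prod_type,
      Finset.sum_comm]
    simp only [Fin.consEquiv_apply, Fin.cons_zero, Fin.prod_univ_succ (n := n), Fin.cons_succ,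
      Fin.castSucc_zero, ← Fin.succ_castSucc]
    simp only [← mul_assoc, ← Finset.sum_mul]
    rw [h1]
    simp only [pow_succ', Matrix.mul_apply, Finset.sum_mul, Finset.mul_sum]
    simp only [mul_assoc]
    rw [Finset.sum_congr rfl fun _ _ => Finset.sum_comm, Finset.sum_comm]
    exact Finset.sum_congr rfl fun _ _ => Finset.sum_comm

lemma ncard_range_word (hA : IsTransitionMatrix A) (n : ℕ) :
    ((range (word (A := A) (n + 1))).ncard : ℝ) = entrySum (A ^ n) := by
  classical
  have hset : range (word (A := A) (n + 1)) =
      ((Finset.univ.filter fun w : Fin (n + 1) → Fin N =>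
        ∀ k : Fin n, A (w k.castSucc) (w k.succ) = 1 : Finset _) : Set _) := by
    ext w
    simp only [Finset.coe_filter, Finset.mem_univ, true_and, mem_ofPred_eq]
    constructor
    · rintro ⟨s, rfl⟩ k
      exact s.2 k
    · exact exists_word_eq hA n w
  rw [hset, ncard_coe_finset, Finset.card_filter, entrySum]
  congr 1
  have := sum_prod_path (A := A) n 1
  simp only [Pi.one_apply, one_mul] at this
  rw [← this]
  refine Finset.sum_congr rfl fun w _ => ?_
  split_ifs with h
  · rw [Finset.prod_eq_one fun k _ => h k]
  · push Not at h
    obtain ⟨k, hk⟩ := h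
    exact (Finset.prod_eq_zero (Finset.mem_univ k) ((hA.zero_or_one _ _).resolve_right hk)).symm

end Subshift

/-! ### Topological entropy as growth rate of the number of words. -/

section Entropy

variable {N : ℕ} {A : Matrix (Fin N) (Fin N) ℕ}

lemma tendsto_log_entrySum_div (hA : IsTransitionMatrix A) :
    Tendsto (fun n : ℕ => Real.log (entrySum (A ^ n)) / n) atTop (𝓝 (Real.log (rho A))) := by
  have hone : 1 ≤ rho A := ge_of_tendsto' (tendsto_rho hA) fun n =>
    Real.one_le_rpow (one_le_entrySum_pow hA n) (by positivity)
  have h := (Real.continuousAt_log (by linarith : rho A ≠ 0)).tendsto.comp (tendsto_rho hA)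
  refine h.congr fun n => ?_
  have hp : 0 < entrySum (A ^ n) := one_pos.trans_le (one_le_entrySum_pow hA n)
  rw [Function.comp_apply, Real.log_rpow hp, one_div, div_eq_inv_mul]

lemma log_entrySum_pow_add_le (hA : IsTransitionMatrix A) (m n : ℕ) :
    Real.log (entrySum (A ^ (m + n))) ≤
      Real.log (entrySum (A ^ m)) + Real.log (entrySum (A ^ n)) := by
  have hp : ∀ n, 0 < entrySum (A ^ n) := fun n => one_pos.trans_le (one_le_entrySum_pow hA n)
  rw [← Real.log_mul (hp m).ne' (hp n).ne']
  refine Real.log_le_log (hp _) ?_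
  rw [pow_add]
  exact entrySum_mul_le _ _

lemma minCard_le {X : Type*} {ℬ : Set (Set X)} {Y : Set X} {s : Finset (Set X)}
    (hs : (s : Set (Set X)) ⊆ ℬ)
    (hY : Y ⊆ ⋃₀ (s : Set (Set X))) : minCard ℬ Y ≤ s.card :=
  Nat.sInf_le ⟨s, hs, hY, rfl⟩

lemma limsup_coe_le {u v : ℕ → ℝ} {a : ℝ} (huv : ∀ᶠ n in atTop, u n ≤ v n)
    (hv : Tendsto v atTop (𝓝 a)) : limsup (fun n => (u n : EReal)) atTop ≤ a := by
  have hv' : Tendsto (fun n => (v n : EReal)) atTop (𝓝 (a : EReal)) :=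
    (continuous_coe_real_ereal.tendsto a).comp hv
  rw [← hv'.limsup_eq]
  exact limsup_le_limsup (huv.mono fun n h => EReal.coe_le_coe_iff.2 h)

lemma le_limsup_coe {u v : ℕ → ℝ} {a : ℝ} (huv : ∀ᶠ n in atTop, v n ≤ u n)
    (hv : Tendsto v atTop (𝓝 a)) : (a : EReal) ≤ limsup (fun n => (u n : EReal)) atTop := by
  have hv' : Tendsto (fun n => (v n : EReal)) atTop (𝓝 (a : EReal)) :=
    (continuous_coe_real_ereal.tendsto a).comp hv
  rw [← hv'.limsup_eq]
  exact limsup_le_limsup (huv.mono fun n h => EReal.coe_le_coe_iff.2 h)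

variable {X : Type*} {f : ℕ → X → X} {G : ℕ → Subshift A → X}

/-- Each `U j` pins down the symbol at time `j`, so one member of the cover cannot contain points
with different words. -/
lemma ncard_range_word_le_card (hstep : ∀ n s, f n (G n s) = G (n + 1) (shift A s))
    {𝒜 : Set (Set X)} (h𝒜 : ∀ U ∈ 𝒜, ∀ n s t, G n s ∈ U → G n t ∈ U → s.1 0 = t.1 0)
    {n : ℕ} {s : Finset (Set X)}
    (hs : (s : Set (Set X)) ⊆ (fun B => B ∩ range (G 0)) '' iterCover f 𝒜 n)
    (hcov : range (G 0) ⊆ ⋃₀ (s : Set (Set X))) :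
    (range (word (A := A) n)).ncard ≤ s.card := by
  classical
  have hrep : ∀ w : range (word (A := A) n), ∃ t : Subshift A, word n t = w := fun w => w.2
  choose rep hrep using hrep
  have hmem : ∀ w, ∃ C ∈ s, G 0 (rep w) ∈ C := fun w => hcov (mem_range_self (rep w))
  choose C hC hmem using hmem
  have hinj : Function.Injective C := by
    intro w w' hww
    obtain ⟨B, ⟨U, hU, rfl⟩, hB⟩ := hs (hC w)
    have h1 := hmem w
    have h2 := hmem w'
    rw [← hww] at h2
    rw [← hB] at h1 h2
    apply Subtype.ext
    rw [← hrep, ← hrep]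
    funext j
    have h3 := mem_iInter.1 h1.1 j
    have h4 := mem_iInter.1 h2.1 j
    rw [mem_preimage, iter_coding hstep] at h3 h4
    have := h𝒜 _ (hU j) _ _ _ h3 h4
    rwa [iterate_shift_apply, iterate_shift_apply] at this
  have : Nat.card (range (word (A := A) n)) ≤ Nat.card s :=
    Nat.card_le_card_of_injective (fun w => (⟨C w, hC w⟩ : s))
      fun _ _ h => hinj (congrArg Subtype.val h)
  rwa [Nat.card_coe_set_eq, Nat.card_eq_fintype_card, Fintype.card_coe] at this

variable [MetricSpace X]

/-- One member per word of length `n + m` suffices: at each time `j < n` a point with the same word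
still shares `m` symbols with the representative, hence lies in the ball around it. -/
lemma exists_cover_card_le (hstep : ∀ n s, f n (G n s) = G (n + 1) (shift A s))
    {𝒜 : Set (Set X)} {ε : ℝ} (h𝒜 : ∀ x, ∃ U ∈ 𝒜, Metric.ball x ε ⊆ U) {m : ℕ}
    (hm : ∀ n s t, (∀ i < m, s.1 i = t.1 i) → dist (G n s) (G n t) < ε) (n : ℕ) :
    ∃ s : Finset (Set X),
      (s : Set (Set X)) ⊆ (fun B => B ∩ range (G 0)) '' iterCover f 𝒜 n ∧
      range (G 0) ⊆ ⋃₀ (s : Set (Set X)) ∧ s.card ≤ (range (word (A := A) (n + m))).ncard := by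
  classical
  choose U hU hball using h𝒜
  let R : Finset (Fin (n + m) → Fin N) := (toFinite (range (word (A := A) (n + m)))).toFinset
  have hR : ∀ w, w ∈ R ↔ ∃ s : Subshift A, word (n + m) s = w := fun w => by simp [R]
  have hrep : ∀ w : R, ∃ s : Subshift A, word (n + m) s = w := fun w => (hR _).1 w.2
  choose rep hrep using hrep
  let B : R → Set X := fun w => ⋂ j : Fin n, iter f j ⁻¹' U (G j ((shift A)^[j] (rep w)))
  refine ⟨Finset.univ.image fun w => B w ∩ range (G 0), ?_, ?_, ?_⟩
  · intro C hC
    simp only [Finset.coe_image, Finset.coe_univ, image_univ, mem_range] at hC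
    obtain ⟨w, rfl⟩ := hC
    exact ⟨B w, ⟨_, fun j => hU _, rfl⟩, rfl⟩
  · rintro _ ⟨s, rfl⟩
    let w : R := ⟨word (n + m) s, (hR _).2 ⟨s, rfl⟩⟩
    refine ⟨B w ∩ range (G 0), by simp, mem_iInter.2 fun j => hball _ ?_, mem_range_self _⟩
    rw [Metric.mem_ball, iter_coding hstep]
    refine hm _ _ _ fun i hi => ?_
    rw [iterate_shift_apply, iterate_shift_apply]
    exact (congrFun (hrep w) ⟨j + i, by omega⟩).symm
  · refine Finset.card_image_le.trans ?_
    rw [Finset.card_univ, Fintype.card_coe, ncard_eq_toFinset_card _ (toFinite _)]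

lemma entropy_coding [CompactSpace X] (hA : IsTransitionMatrix A)
    (hstep : ∀ n s, f n (G n s) = G (n + 1) (shift A s))
    (hsmall : ∀ ε > 0, ∃ m : ℕ, ∀ n s t, (∀ i < m, s.1 i = t.1 i) → dist (G n s) (G n t) < ε)
    (hsep : ∀ m : ℕ, ∃ δ > 0, ∀ n s t, dist (G n s) (G n t) < δ → ∀ i < m, s.1 i = t.1 i) :
    entropy f (range (G 0)) = ((Real.log (rho A) : ℝ) : EReal) := by
  have hlim := tendsto_log_entrySum_div hA
  have hcover : ∀ 𝒜 : Set (Set X), (∀ U ∈ 𝒜, IsOpen U) → ⋃₀ 𝒜 = univ → ∃ m : ℕ, ∀ n : ℕ,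
      ∃ s : Finset (Set X),
        (s : Set (Set X)) ⊆ (fun B => B ∩ range (G 0)) '' iterCover f 𝒜 n ∧
        range (G 0) ⊆ ⋃₀ (s : Set (Set X)) ∧
        s.card ≤ (range (word (A := A) (n + m + 1))).ncard := by
    intro 𝒜 hopen hcov
    obtain ⟨ε, hε, hleb⟩ := lebesgue_number_lemma_of_metric_sUnion isCompact_univ hopen hcov.ge
    obtain ⟨m, hm⟩ := hsmall ε hε
    exact ⟨m, fun n => exists_cover_card_le hstep (m := m + 1) (fun x => hleb x (mem_univ x))
      (fun n s t h => hm n s t fun i hi => h i (by omega)) n⟩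
  refine le_antisymm ?_ ?_
  · refine iSup₂_le fun 𝒜 h𝒜 => ?_
    obtain ⟨m, hm⟩ := hcover 𝒜 h𝒜.1 h𝒜.2
    have hv := hlim.add (tendsto_const_div_atTop_nhds_zero_nat (Real.log (entrySum (A ^ m))))
    rw [add_zero] at hv
    refine limsup_coe_le (Eventually.of_forall fun n => ?_) hv
    rw [← add_div]
    refine div_le_div_of_nonneg_right ?_ (Nat.cast_nonneg n)
    refine le_trans ?_ (log_entrySum_pow_add_le hA n m)
    obtain ⟨s, hs, hcov, hcard⟩ := hm n
    rw [← ncard_range_word hA (n + m)]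
    -- If `minCard` is `0`, the convention `Real.log 0 = 0` makes the bound trivial.
    rcases Nat.eq_zero_or_pos
      (minCard ((fun B => B ∩ range (G 0)) '' iterCover f 𝒜 n) (range (G 0))) with h0 | h0
    · rw [h0, Nat.cast_zero, Real.log_zero]
      exact Real.log_natCast_nonneg _
    · exact Real.log_le_log (by exact_mod_cast h0)
        (by exact_mod_cast (minCard_le hs hcov).trans hcard)
  · obtain ⟨δ, hδ, hδs⟩ := hsep 1
    -- Two coded points at the same time in one such ball are less than `δ` apart, so they share
    -- their first symbol.
    let 𝒜 : Set (Set X) := range fun x => Metric.ball x (δ / 2)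
    have hopen : ∀ U ∈ 𝒜, IsOpen U := by
      rintro _ ⟨x, rfl⟩
      exact Metric.isOpen_ball
    have hcov : ⋃₀ 𝒜 = univ := eq_univ_of_forall fun x =>
      ⟨_, mem_range_self x, Metric.mem_ball_self (half_pos hδ)⟩
    refine le_trans ?_ (le_iSup₂ (f := fun (𝒜 : Set (Set X))
      (_ : (∀ U ∈ 𝒜, IsOpen U) ∧ ⋃₀ 𝒜 = univ) => limsup (fun n : ℕ =>
      ((Real.log (minCard ((fun B => B ∩ range (G 0)) '' iterCover f 𝒜 n) (range (G 0))) / n : ℝ) :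
        EReal)) atTop) 𝒜 ⟨hopen, hcov⟩)
    -- A finite subcover must exist for the infimum `minCard` to be bounded below by `le_csInf`.
    obtain ⟨m, hm⟩ := hcover 𝒜 hopen hcov
    have hv := hlim.sub (tendsto_const_div_atTop_nhds_zero_nat (Real.log (entrySum (A ^ 1))))
    rw [sub_zero] at hv
    refine le_limsup_coe ?_ hv
    filter_upwards [eventually_ge_atTop 1] with n hn
    obtain ⟨k, rfl⟩ := Nat.exists_eq_add_of_le' hn
    rw [← sub_div]
    refine div_le_div_of_nonneg_right ?_ (Nat.cast_nonneg _)
    rw [sub_le_iff_le_add]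
    refine (log_entrySum_pow_add_le hA k 1).trans (add_le_add_left ?_ _)
    refine Real.log_le_log (one_pos.trans_le (one_le_entrySum_pow hA k)) ?_
    rw [← ncard_range_word hA k, Nat.cast_le]
    refine le_csInf ?_ ?_
    · obtain ⟨s, hs, hs', _⟩ := hm (k + 1)
      exact ⟨_, s, hs, hs', rfl⟩
    · rintro _ ⟨s, hs, hs', rfl⟩
      refine ncard_range_word_le_card hstep ?_ hs hs'
      rintro _ ⟨x, rfl⟩ n s t h1 h2
      refine hδs n s t ?_ 0 one_pos
      rw [Metric.mem_ball] at h1 h2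
      linarith [dist_triangle_right (G n s) (G n t) x]

end Entropy

/-! ### Encoding bit sequences by concatenated loops. -/

section Blocks

variable {N : ℕ} {A : Matrix (Fin N) (Fin N) ℕ}

lemma exists_path (hA : IsTransitionMatrix A) (k : ℕ) : ∀ i j, 0 < (A ^ k) i j →
    ∃ w : ℕ → Fin N, w 0 = i ∧ w k = j ∧ ∀ t < k, A (w t) (w (t + 1)) = 1 := by
  induction k with
  | zero =>
    intro i j h
    have hij : i = j := by
      by_contra hne
      simp [hne] at h
    exact ⟨fun _ => i, rfl, hij, by simp⟩
  | succ k ih =>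
    intro i j h
    rw [pow_succ', Matrix.mul_apply] at h
    obtain ⟨l, -, hl⟩ := Finset.exists_ne_zero_of_sum_ne_zero h.ne'
    obtain ⟨w, h0, hk, hw⟩ := ih l j (Nat.pos_of_ne_zero (right_ne_zero_of_mul hl))
    have hil := (hA.zero_or_one i l).resolve_left (left_ne_zero_of_mul hl)
    refine ⟨fun t => Nat.casesOn t i w, rfl, hk, fun t ht => ?_⟩
    cases t with
    | zero => simpa [h0] using hil
    | succ t => exact hw t (by omega)

/-- `w` is a loop of length `p` at the vertex `i`. -/
def IsLoop (A : Matrix (Fin N) (Fin N) ℕ) (i : Fin N) (p : ℕ) (w : ℕ → Fin N) : Prop :=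
  w 0 = i ∧ w p = i ∧ ∀ t < p, A (w t) (w (t + 1)) = 1

lemma exists_loop (hA : IsTransitionMatrix A) (hirr : IsIrreducible A) {i j : Fin N}
    (hij : A i j = 1) : ∃ p w, 2 ≤ p ∧ IsLoop A i p w ∧ w 1 = j := by
  obtain ⟨k, hk, hpos⟩ := hirr j i
  obtain ⟨w, h0, hwk, hw⟩ := exists_path hA k j i hpos
  refine ⟨k + 1, fun t => Nat.casesOn t i w, by omega, ⟨rfl, hwk, fun t ht => ?_⟩, h0⟩
  cases t with
  | zero => simpa [h0] using hij
  | succ t => exact hw t (by omega)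

lemma IsLoop.append {i : Fin N} {p q : ℕ} {u v : ℕ → Fin N} (hu : IsLoop A i p u)
    (hv : IsLoop A i q v) (hp : 2 ≤ p) :
    ∃ w, IsLoop A i (p + q) w ∧ w 1 = u 1 := by
  obtain ⟨u0, up, hu⟩ := hu
  obtain ⟨v0, vq, hv⟩ := hv
  refine ⟨fun t => if t < p then u t else v (t - p), ⟨?_, ?_, fun t ht => ?_⟩, if_pos hp⟩
  · simp [show 0 < p by omega, u0]
  · simp [vq]
  · rcases lt_trichotomy (t + 1) p with h | h | h
    · simpa [h, show t < p by omega] using hu t (by omega)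
    · have := hu t (by omega)
      rw [h, up, ← v0] at this
      simpa [h, show t < p by omega] using this
    · have := hv (t - p) (by omega)
      rw [show t - p + 1 = t + 1 - p by omega] at this
      simpa [show ¬ t < p by omega, show ¬ t + 1 < p by omega] using this

/-- Two loops of equal length at a branching vertex that differ in their second letter. -/
lemma exists_two_loops (hA : IsTransitionMatrix A) (hirr : IsIrreducible A)
    (hbranch : ∃ i₀, 2 ≤ ∑ j, A i₀ j) :
    ∃ i L, 2 ≤ L ∧ ∃ blk : Bool → ℕ → Fin N, (∀ b, IsLoop A i L (blk b)) ∧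
      blk true 1 ≠ blk false 1 := by
  obtain ⟨i, hi⟩ := hbranch
  obtain ⟨j, hj⟩ := hA.exists_succ i
  obtain ⟨j', hne, hj'⟩ : ∃ j', j ≠ j' ∧ A i j' = 1 := by
    by_contra! h
    have : ∑ l, A i l = A i j := Finset.sum_eq_single j
      (fun l _ hl => (hA.zero_or_one i l).resolve_right (h l hl.symm)) (by simp)
    omega
  obtain ⟨p, u, hp, hu, hu1⟩ := exists_loop hA hirr hj
  obtain ⟨q, v, hq, hv, hv1⟩ := exists_loop hA hirr hj'
  -- Both orders of concatenation, `u` then `v` and `v` then `u`, have length `p + q`, yet keep the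
  -- second letters `j` and `j'`.
  obtain ⟨U, hU, hU1⟩ := hu.append hv hp
  obtain ⟨V, hV, hV1⟩ := hv.append hu hq
  rw [add_comm] at hV
  refine ⟨i, p + q, by omega, fun b => cond b U V, fun b => ?_, ?_⟩
  · cases b
    exacts [hV, hU]
  · simpa [hU1, hV1, hu1, hv1] using hne

/-- The concatenation of loops at a common vertex, as prescribed by `b`. -/
def blockSeq {i : Fin N} {L : ℕ} (hL : 2 ≤ L) {blk : Bool → ℕ → Fin N}
    (hblk : ∀ b, IsLoop A i L (blk b)) (b : ℕ → Bool) : Subshift A :=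
  ⟨fun n => blk (b (n / L)) (n % L), fun n => by
    have hlt : n % L < L := Nat.mod_lt _ (by omega)
    have hn : L * (n / L) + n % L = n := Nat.div_add_mod n L
    have h := (hblk (b (n / L))).2.2 (n % L) hlt
    rcases Nat.lt_or_ge (n % L + 1) L with h1 | h1
    · have hd : (n + 1) / L = n / L :=
        Nat.div_eq_of_lt_le (by rw [mul_comm]; omega) (by rw [mul_comm, mul_add]; omega)
      have hm : (n + 1) % L = n % L + 1 := by rw [Nat.add_mod, Nat.mod_eq_of_lt (a := 1) (by omega),
        Nat.mod_eq_of_lt h1]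
      change A (blk (b (n / L)) (n % L)) (blk (b ((n + 1) / L)) ((n + 1) % L)) = 1
      rwa [hd, hm]
    · have he : n % L + 1 = L := by omega
      have hm : (n + 1) % L = 0 :=
        Nat.mod_eq_zero_of_dvd ⟨n / L + 1, by rw [mul_add]; omega⟩
      rw [he, (hblk _).2.1] at h
      change A (blk (b (n / L)) (n % L)) (blk (b ((n + 1) / L)) ((n + 1) % L)) = 1
      rw [hm, (hblk _).1]
      exact h⟩

/-- The bit sequence that repeats on each of the rapidly growing intervals
`[2 ^ 2 ^ m, 2 ^ 2 ^ (m + 1))` either `false` or a bit of `c`. -/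
def spreadBits (c : ℕ → Bool) (k : ℕ) : Bool :=
  Nat.casesOn (Nat.unpair (Nat.log 2 (Nat.log 2 k))).1 false c

lemma spreadBits_eq {c : ℕ → Bool} {m k : ℕ} (h1 : 2 ^ 2 ^ m ≤ k) (h2 : k < 2 ^ 2 ^ (m + 1)) :
    spreadBits c k = Nat.casesOn (Nat.unpair m).1 false c := by
  have hk : k ≠ 0 := by
    have : 0 < 2 ^ 2 ^ m := by positivity
    omega
  have hlog : Nat.log 2 (Nat.log 2 k) = m :=
    Nat.log_eq_of_pow_le_of_lt_pow (Nat.le_log_of_pow_le one_lt_two h1)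
      (Nat.log_lt_of_lt_pow hk h2)
  rw [spreadBits, hlog]

lemma frequently_unpair_fst (t : ℕ) : ∃ᶠ m in atTop, (Nat.unpair m).1 = t :=
  frequently_atTop.2 fun k => ⟨Nat.pair t k, Nat.right_le_pair t k, by simp⟩

/-- Intervals whose index unpairs to first component `0` carry `false` whatever `c` is. -/
lemma frequently_blockSeq_agree {i : Fin N} {L : ℕ} (hL : 2 ≤ L) {blk : Bool → ℕ → Fin N}
    (hblk : ∀ b, IsLoop A i L (blk b)) (c c' : ℕ → Bool) :
    ∃ᶠ m in atTop, ∀ n, L * 2 ^ 2 ^ m ≤ n → n < L * 2 ^ 2 ^ (m + 1) →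
      (blockSeq hL hblk (spreadBits c)).1 n = (blockSeq hL hblk (spreadBits c')).1 n := by
  refine (frequently_unpair_fst 0).mono fun m hm n h1 h2 => ?_
  have h1' : 2 ^ 2 ^ m ≤ n / L := (Nat.le_div_iff_mul_le (by omega)).2 (by rwa [mul_comm])
  have h2' : n / L < 2 ^ 2 ^ (m + 1) := Nat.div_lt_of_lt_mul h2
  change blk (spreadBits c (n / L)) (n % L) = blk (spreadBits c' (n / L)) (n % L)
  congr 1
  rw [spreadBits_eq h1' h2', spreadBits_eq h1' h2', hm]
  rfl

/-- If `c t ≠ c' t`, the intervals of type `t + 1` carry different loops throughout, and these are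
told apart by the second letter of each. -/
lemma frequently_blockSeq_differ {i : Fin N} {L : ℕ} (hL : 2 ≤ L) {blk : Bool → ℕ → Fin N}
    (hblk : ∀ b, IsLoop A i L (blk b)) (hne : blk true 1 ≠ blk false 1) {c c' : ℕ → Bool}
    (hc : c ≠ c') :
    ∃ᶠ m in atTop, ∀ n, L * 2 ^ 2 ^ m ≤ n → n + (L + 2) < L * 2 ^ 2 ^ (m + 1) →
      ∃ j < L + 2, (blockSeq hL hblk (spreadBits c)).1 (n + j) ≠
        (blockSeq hL hblk (spreadBits c')).1 (n + j) := by
  obtain ⟨t, ht⟩ := Function.ne_iff.1 hc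
  refine (frequently_unpair_fst (t + 1)).mono fun m hm n h1 h2 => ?_
  have hlt : n % L < L := Nat.mod_lt _ (by omega)
  have hn : L * (n / L) + n % L = n := Nat.div_add_mod n L
  have hq : L * (n / L + 1) = L * (n / L) + L := by ring
  have h1' : 2 ^ 2 ^ m ≤ n / L + 1 :=
    ((Nat.le_div_iff_mul_le (by omega)).2 (by rwa [mul_comm])).trans (Nat.le_succ _)
  have h2' : n / L + 1 < 2 ^ 2 ^ (m + 1) := by
    refine Nat.lt_of_mul_lt_mul_left (a := L) ?_
    omega
  -- This offset leads to the second letter of the next loop, at most `L + 1` places ahead.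
  refine ⟨L * (n / L + 1) + 1 - n, by omega, ?_⟩
  rw [show n + (L * (n / L + 1) + 1 - n) = L * (n / L + 1) + 1 by omega]
  have hd : (L * (n / L + 1) + 1) / L = n / L + 1 := by
    rw [Nat.mul_add_div (by omega), Nat.div_eq_of_lt (by omega : 1 < L), add_zero]
  have hm' : (L * (n / L + 1) + 1) % L = 1 := by
    rw [Nat.mul_add_mod, Nat.mod_eq_of_lt (by omega)]
  simp only [blockSeq]
  rw [hd, hm', spreadBits_eq h1' h2', spreadBits_eq h1' h2', hm]
  change blk (c t) 1 ≠ blk (c' t) 1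
  cases h : c t <;> cases h' : c' t <;> simp_all [hne.symm]

end Blocks

/-! ### Frequencies along rapidly growing intervals. -/

section Density

lemma sum_range_le_of_eq_zero {g : ℕ → ℝ} (h1 : ∀ i, g i ≤ 1) {a b r : ℕ}
    (h : ∀ i, a ≤ i → i + r < b → g i = 0) : ∑ i ∈ Finset.range b, g i ≤ a + r := by
  classical
  have hle : ∀ i ∈ Finset.range b,
      g i ≤ if i ∈ Finset.range a ∪ Finset.Ico (b - r) b then 1 else 0 := by
    intro i hi
    split_ifs with hmem
    · exact h1 i
    · simp only [Finset.mem_union, Finset.mem_range, Finset.mem_Ico, not_or] at hmem hi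
      exact (h i (by omega) (by omega)).le
  refine (Finset.sum_le_sum hle).trans ?_
  rw [← Finset.sum_filter, Finset.sum_const, nsmul_one, ← Nat.cast_add, Nat.cast_le]
  refine (Finset.card_le_card (t := Finset.range a ∪ Finset.Ico (b - r) b)
    fun i hi => (Finset.mem_filter.1 hi).2).trans ?_
  refine (Finset.card_union_le _ _).trans ?_
  simp only [Finset.card_range, Nat.card_Ico]
  omega

/-- With `M = 2 ^ 2 ^ m` the denominator is `L * M ^ 2`, so the quotient is at most `(1 + r) / M`:
the past is negligible at the end of an interval. -/
lemma tendsto_block_start_div (L r : ℕ) (hL : 0 < L) :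
    Tendsto (fun m : ℕ => (((L * 2 ^ 2 ^ m : ℕ) : ℝ) + r) / (L * 2 ^ 2 ^ (m + 1) : ℕ)) atTop
      (𝓝 0) := by
  have hM : Tendsto (fun m : ℕ => ((2 : ℝ) ^ 2 ^ m)) atTop atTop :=
    (tendsto_pow_atTop_atTop_of_one_lt one_lt_two).comp
      (tendsto_pow_atTop_atTop_of_one_lt one_lt_two)
  have hlim : Tendsto (fun m : ℕ => (1 + r : ℝ) / (2 : ℝ) ^ 2 ^ m) atTop (𝓝 0) :=
    hM.const_div_atTop _
  refine squeeze_zero (fun m => by positivity) (fun m => ?_) hlim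
  have hL1 : (1 : ℝ) ≤ L := by exact_mod_cast hL
  have hM1 : (1 : ℝ) ≤ 2 ^ 2 ^ m := one_le_pow₀ one_le_two
  have hr : (0 : ℝ) ≤ r := Nat.cast_nonneg r
  push_cast
  rw [pow_succ 2 m, pow_mul, div_le_div_iff₀ (by positivity) (by positivity)]
  set M : ℝ := 2 ^ 2 ^ m
  have : (r : ℝ) ≤ L * M * r := by
    nlinarith [mul_le_mul hL1 hM1 zero_le_one (by linarith : (0 : ℝ) ≤ L)]
  nlinarith [mul_le_mul_of_nonneg_right this (by linarith : (0 : ℝ) ≤ M)]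

lemma tendsto_block_end (L : ℕ) (hL : 0 < L) :
    Tendsto (fun m : ℕ => L * 2 ^ 2 ^ (m + 1)) atTop atTop := by
  refine Tendsto.const_mul_atTop' hL ?_
  exact ((tendsto_pow_atTop_atTop_of_one_lt one_lt_two).comp
    (tendsto_pow_atTop_atTop_of_one_lt one_lt_two)).comp (tendsto_add_atTop_nat 1)

lemma eventually_block_start_add_lt (L r : ℕ) (hL : 0 < L) :
    ∀ᶠ m : ℕ in atTop, L * 2 ^ 2 ^ m + r < L * 2 ^ 2 ^ (m + 1) := by
  filter_upwards [(tendsto_block_start_div L r hL).eventually_lt_const one_pos] with m hm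
  rw [div_lt_one (by positivity)] at hm
  exact_mod_cast hm

lemma tendsto_block_start (L : ℕ) (hL : 0 < L) :
    Tendsto (fun m : ℕ => L * 2 ^ 2 ^ m) atTop atTop :=
  (tendsto_add_atTop_iff_nat 1).1 (tendsto_block_end L hL)

variable {X : Type*} [MetricSpace X] {f : ℕ → X → X} {x y : X}

lemma indicator_one_le_one (ε z : ℝ) : (Ico (0 : ℝ) ε).indicator (fun _ => (1 : ℝ)) z ≤ 1 :=
  indicator_apply_le' (fun _ => le_rfl) fun _ => zero_le_one

lemma closeFreq_nonneg (ε : ℝ) (n : ℕ) : 0 ≤ closeFreq f x y ε n :=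
  mul_nonneg (by positivity) (Finset.sum_nonneg fun _ _ => indicator_nonneg (by simp) _)

lemma closeFreq_le_one (ε : ℝ) (n : ℕ) : closeFreq f x y ε n ≤ 1 := by
  unfold closeFreq
  rw [one_div, inv_mul_eq_div]
  refine div_le_one_of_le₀ ?_ (Nat.cast_nonneg n)
  calc _ ≤ ∑ _i ∈ Finset.range n, (1 : ℝ) :=
        Finset.sum_le_sum fun i _ => indicator_one_le_one _ _
    _ = n := by simp

lemma limsup_closeFreq_eq_one {L : ℕ} (hL : 0 < L) {ε : ℝ} {r : ℕ}
    (h : ∃ᶠ m in atTop, ∀ i, L * 2 ^ 2 ^ m ≤ i → i + r < L * 2 ^ 2 ^ (m + 1) →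
      dist (iter f i x) (iter f i y) < ε) : limsup (closeFreq f x y ε) atTop = 1 := by
  have hbdd : IsBoundedUnder (· ≤ ·) atTop (closeFreq f x y ε) :=
    isBoundedUnder_of ⟨1, closeFreq_le_one ε⟩
  have hcobdd : IsCoboundedUnder (· ≤ ·) atTop (closeFreq f x y ε) :=
    (isBoundedUnder_of ⟨0, closeFreq_nonneg ε⟩ : IsBoundedUnder (· ≥ ·) atTop _).isCoboundedUnder_le
  refine le_antisymm (limsup_le_of_le hcobdd (Eventually.of_forall (closeFreq_le_one ε)))
    (le_of_forall_lt fun c hc => ?_)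
  obtain ⟨c', hcc', hc'⟩ := exists_between hc
  refine hcc'.trans_le (le_limsup_of_frequently_le ?_ hbdd)
  refine (tendsto_block_end L hL).frequently ?_
  refine (h.and_eventually ((tendsto_block_start_div L r hL).eventually_lt_const
    (sub_pos.2 hc'))).mono fun m ⟨hm, hlt⟩ => ?_
  set b := L * 2 ^ 2 ^ (m + 1) with hb
  have hb0 : (0 : ℝ) < b := by rw [hb]; positivity
  -- The times that are not close are counted: up to the end of the interval they fall in its past
  -- or among its last `r` places.
  have hsum := sum_range_le_of_eq_zero
    (a := L * 2 ^ 2 ^ m) (b := b) (r := r)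
    (g := fun i => 1 - (Ico (0 : ℝ) ε).indicator (fun _ => (1 : ℝ))
      (dist (iter f i x) (iter f i y)))
    (fun i => sub_le_self _ (indicator_nonneg (by simp) _))
    (fun i h1 h2 => by rw [indicator_of_mem (mem_Ico.2 ⟨dist_nonneg, hm i h1 h2⟩), sub_self])
  rw [Finset.sum_sub_distrib] at hsum
  simp only [Finset.sum_const, Finset.card_range, nsmul_one] at hsum
  rw [div_lt_iff₀ hb0] at hlt
  unfold closeFreq
  rw [one_div, inv_mul_eq_div, le_div_iff₀ hb0]
  linarith

lemma liminf_closeFreq_eq_zero {L : ℕ} (hL : 0 < L) {δ : ℝ} {r : ℕ}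
    (h : ∃ᶠ m in atTop, ∀ i, L * 2 ^ 2 ^ m ≤ i → i + r < L * 2 ^ 2 ^ (m + 1) →
      δ ≤ dist (iter f i x) (iter f i y)) : liminf (closeFreq f x y δ) atTop = 0 := by
  have hbdd : IsBoundedUnder (· ≥ ·) atTop (closeFreq f x y δ) :=
    isBoundedUnder_of ⟨0, closeFreq_nonneg δ⟩
  have hcobdd : IsCoboundedUnder (· ≥ ·) atTop (closeFreq f x y δ) :=
    (isBoundedUnder_of ⟨1, closeFreq_le_one δ⟩ : IsBoundedUnder (· ≤ ·) atTop _).isCoboundedUnder_ge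
  refine le_antisymm (le_of_forall_gt fun c hc => ?_)
    (le_liminf_of_le hcobdd (Eventually.of_forall (closeFreq_nonneg δ)))
  obtain ⟨c', hc', hcc'⟩ := exists_between hc
  refine (liminf_le_of_frequently_le ?_ hbdd).trans_lt hcc'
  refine (tendsto_block_end L hL).frequently ?_
  refine (h.and_eventually ((tendsto_block_start_div L r hL).eventually_lt_const
    hc')).mono fun m ⟨hm, hlt⟩ => ?_
  set b := L * 2 ^ 2 ^ (m + 1) with hb
  have hb0 : (0 : ℝ) < b := by rw [hb]; positivity
  have hsum := sum_range_le_of_eq_zero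
    (g := fun i => (Ico (0 : ℝ) δ).indicator (fun _ => (1 : ℝ))
      (dist (iter f i x) (iter f i y)))
    (fun i => indicator_one_le_one _ _)
    (fun i h1 h2 => indicator_of_notMem (fun hmem => (hm i h1 h2).not_gt hmem.2) _)
  unfold closeFreq
  rw [one_div, inv_mul_eq_div]
  exact (div_le_div_of_nonneg_right hsum hb0.le).trans hlt.le

end Density

/-! ### Scrambled sets. -/

section Chaos

variable {N : ℕ} {A : Matrix (Fin N) (Fin N) ℕ}
variable {X : Type*} [MetricSpace X] {f : ℕ → X → X} {G : ℕ → Subshift A → X}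

/-- An uncountable family of coded points, any two of which have orbits that are alternately
close together and apart along rapidly growing time intervals. -/
lemma exists_scrambled_family (hA : IsTransitionMatrix A) (hirr : IsIrreducible A)
    (hbranch : ∃ i₀, 2 ≤ ∑ j, A i₀ j)
    (hstep : ∀ n s, f n (G n s) = G (n + 1) (shift A s))
    (hsmall : ∀ ε > 0, ∃ m : ℕ, ∀ n s t, (∀ i < m, s.1 i = t.1 i) → dist (G n s) (G n t) < ε)
    (hsep : ∀ m : ℕ, ∃ δ > 0, ∀ n s t, dist (G n s) (G n t) < δ → ∀ i < m, s.1 i = t.1 i) :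
    ∃ S ⊆ range (G 0), ¬ S.Countable ∧ ∃ L > 0, ∃ δ > 0, ∃ r, ∀ x ∈ S, ∀ y ∈ S, x ≠ y →
      (∀ ε > 0, ∃ q, ∃ᶠ m in atTop, ∀ i, L * 2 ^ 2 ^ m ≤ i → i + q < L * 2 ^ 2 ^ (m + 1) →
        dist (iter f i x) (iter f i y) < ε) ∧
      ∃ᶠ m in atTop, ∀ i, L * 2 ^ 2 ^ m ≤ i → i + r < L * 2 ^ 2 ^ (m + 1) →
        δ ≤ dist (iter f i x) (iter f i y) := by
  obtain ⟨i₀, L, hL, blk, hblk, hne⟩ := exists_two_loops hA hirr hbranch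
  -- `L + 2` is the window within which two differing block sequences must show a difference.
  obtain ⟨δ, hδ, hδs⟩ := hsep (L + 2)
  let p : (ℕ → Bool) → X := fun c => G 0 (blockSeq hL hblk (spreadBits c))
  have hfar : ∀ c c', c ≠ c' → ∃ᶠ m in atTop, ∀ i, L * 2 ^ 2 ^ m ≤ i →
      i + (L + 2) < L * 2 ^ 2 ^ (m + 1) → δ ≤ dist (iter f i (p c)) (iter f i (p c')) := by
    intro c c' hc
    refine (frequently_blockSeq_differ hL hblk hne hc).mono fun m hm i h1 h2 => ?_
    obtain ⟨j, hj, hdiff⟩ := hm i h1 h2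
    by_contra! hlt
    rw [iter_coding hstep, iter_coding hstep] at hlt
    have := hδs _ _ _ hlt j hj
    rw [iterate_shift_apply, iterate_shift_apply] at this
    exact hdiff this
  have hinj : Function.Injective p := by
    intro c c' hcc
    by_contra hc
    -- Equal points would have orbits at distance `0`, against the bound `δ` at the start of a long
    -- interval.
    obtain ⟨m, hm, hlt⟩ := ((hfar c c' hc).and_eventually
      (eventually_block_start_add_lt L (L + 2) (by omega))).exists
    have := hm _ le_rfl hlt
    rw [hcc, dist_self] at this
    linarith
  refine ⟨range p, range_subset_iff.2 fun c => mem_range_self _, fun hcount => ?_,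
    L, by omega, δ, hδ, L + 2, ?_⟩
  · have : Countable (range p) := hcount.to_subtype
    have hc : Countable (ℕ → Bool) := (rangeFactorization_injective.2 hinj).countable
    have huncard : Cardinal.aleph0 < Cardinal.mk (ℕ → Bool) := by
      rw [← Cardinal.power_def, Cardinal.mk_bool, Cardinal.mk_nat]
      exact Cardinal.cantor _
    exact huncard.not_ge (Cardinal.mk_le_aleph0_iff.2 hc)
  · rintro _ ⟨c, rfl⟩ _ ⟨c', rfl⟩ hxy
    refine ⟨fun ε hε => ?_, hfar c c' fun h => hxy (congrArg p h)⟩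
    obtain ⟨q, hq⟩ := hsmall ε hε
    refine ⟨q, (frequently_blockSeq_agree hL hblk c c').mono fun m hm i h1 h2 => ?_⟩
    rw [iter_coding hstep, iter_coding hstep]
    refine hq _ _ _ fun j hj => ?_
    rw [iterate_shift_apply, iterate_shift_apply]
    exact hm _ (by omega) (by omega)

lemma chaos_of_coding (hA : IsTransitionMatrix A) (hirr : IsIrreducible A)
    (hbranch : ∃ i₀, 2 ≤ ∑ j, A i₀ j)
    (hstep : ∀ n s, f n (G n s) = G (n + 1) (shift A s))
    (hsmall : ∀ ε > 0, ∃ m : ℕ, ∀ n s t, (∀ i < m, s.1 i = t.1 i) → dist (G n s) (G n t) < ε)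
    (hsep : ∀ m : ℕ, ∃ δ > 0, ∀ n s t, dist (G n s) (G n t) < δ → ∀ i < m, s.1 i = t.1 i)
    (hbdd : ∀ s, Bornology.IsBounded (range fun n => iter f n (G 0 s))) :
    DistributionallyChaotic f ∧ StronglyLiYorkeChaotic f := by
  obtain ⟨S, hSG, hS, L, hL, δ, hδ, r, h⟩ :=
    exists_scrambled_family hA hirr hbranch hstep hsmall hsep
  refine ⟨⟨S, hS, fun x hx y hy hxy => ⟨fun ε hε => ?_, δ, hδ, ?_⟩⟩,
    δ / 2, half_pos hδ, S, hS, fun x hx y hy hxy => ⟨?_, ?_⟩, ?_⟩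
  · obtain ⟨q, hq⟩ := (h x hx y hy hxy).1 ε hε
    exact limsup_closeFreq_eq_one hL hq
  · exact liminf_closeFreq_eq_zero hL (h x hx y hy hxy).2
  · refine le_antisymm (le_of_forall_gt fun ε hε => ?_) zero_le
    obtain ⟨ε', hε', hεε⟩ := ENNReal.lt_iff_exists_nnreal_btwn.1 hε
    obtain ⟨q, hq⟩ := (h x hx y hy hxy).1 ε' (by exact_mod_cast hε')
    refine (liminf_le_of_frequently_le' ?_).trans_lt hεε
    -- One time per interval suffices here; the starting time is taken once the interval is longer
    -- than `q`.
    refine (tendsto_block_start L hL).frequently ?_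
    refine (hq.and_eventually (eventually_block_start_add_lt L q hL)).mono fun m ⟨hm, hlt⟩ => ?_
    have := hm _ le_rfl hlt
    rw [edist_nndist]
    exact_mod_cast this.le
  · refine ((ENNReal.ofReal_lt_ofReal_iff hδ).2 (half_lt_self hδ)).trans_le
      (le_limsup_of_frequently_le' ?_)
    refine (tendsto_block_start L hL).frequently ?_
    refine ((h x hx y hy hxy).2.and_eventually
      (eventually_block_start_add_lt L r hL)).mono fun m ⟨hm, hlt⟩ => ?_
    rw [edist_dist]
    exact ENNReal.ofReal_le_ofReal (hm _ le_rfl hlt)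
  · intro x hx
    obtain ⟨s, rfl⟩ := hSG hx
    exact hbdd s

end Chaos

/-! ### Invariance and equi-conjugacy. -/

section Conjugacy

variable {N : ℕ} {A : Matrix (Fin N) (Fin N) ℕ}
variable {X : Type*} {f : ℕ → X → X} {G : ℕ → Subshift A → X}

/-- Equality, not mere inclusion, rests on surjectivity of the shift, that is, on the nonzero
columns of `A`. -/
lemma image_range_coding (hA : IsTransitionMatrix A)
    (hstep : ∀ n s, f n (G n s) = G (n + 1) (shift A s)) (n : ℕ) :
    f n '' range (G n) = range (G (n + 1)) := by
  rw [← range_comp, ← (shift_surjective hA).range_comp (G (n + 1))]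
  exact congrArg range (funext fun s => hstep n s)

variable [MetricSpace X]

lemma equiConjugate_coding (hA : IsTransitionMatrix A)
    (hstep : ∀ n s, f n (G n s) = G (n + 1) (shift A s))
    (hsmall : ∀ ε > 0, ∃ m : ℕ, ∀ n s t, (∀ i < m, s.1 i = t.1 i) → dist (G n s) (G n t) < ε)
    (hsep : ∀ m : ℕ, ∃ δ > 0, ∀ n s t, dist (G n s) (G n t) < δ → ∀ i < m, s.1 i = t.1 i) :
    EquiConjugate f (fun n => range (G n)) (fun _ => shift A) (fun _ => univ) := by
  have hinj : ∀ n, Function.Injective (G n) := fun n s t hst => by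
    refine Subtype.ext (funext fun i => ?_)
    obtain ⟨δ, hδ, h⟩ := hsep (i + 1)
    exact h n s t (by rwa [hst, dist_self]) i (Nat.lt_succ_self i)
  let h : ∀ n, range (G n) ≃ (univ : Set (Subshift A)) := fun n =>
    (Equiv.ofInjective (G n) (hinj n)).symm.trans (Equiv.Set.univ _).symm
  have hh : ∀ n s, h n ⟨G n s, mem_range_self s⟩ = ⟨s, mem_univ s⟩ := fun n s =>
    (h n).apply_symm_apply ⟨s, mem_univ s⟩
  refine ⟨fun n => mapsTo_iff_image_subset.2 (image_range_coding hA hstep n).subset,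
    fun n => mapsTo_univ _ _, h, ?_, ?_, ?_⟩
  · rintro n ⟨_, s, rfl⟩
    simp only [hstep, hh]
  · intro ε hε
    obtain ⟨m, hm⟩ := dist_lt_of_agree (A := A) hε
    obtain ⟨δ, hδ, hs⟩ := hsep m
    refine ⟨δ, hδ, ?_⟩
    rintro n ⟨_, s, rfl⟩ ⟨_, t, rfl⟩ hst
    simp only [hh]
    exact hm s t (hs n s t hst)
  · intro ε hε
    obtain ⟨m, hm⟩ := hsmall ε hε
    obtain ⟨δ, hδ, hs⟩ := agree_of_dist_lt (A := A) m
    refine ⟨δ, hδ, ?_⟩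
    rintro n ⟨s, _⟩ ⟨t, _⟩ hst
    exact hm n s t (hs s t hst)

end Conjugacy

lemma setDist_le_dist {X : Type*} [MetricSpace X] {B C : Set X} {x y : X} (hx : x ∈ B)
    (hy : y ∈ C) : setDist B C ≤ dist x y := by
  refine csInf_le ⟨0, ?_⟩ ⟨x, hx, y, hy, rfl⟩
  rintro _ ⟨b, _, c, _, rfl⟩
  exact dist_nonneg

end NDS

/-! ### Assembly of the theorem. -/

theorem theorem3p7 {X : Type*} [MetricSpace X] (f : ℕ → X → X) {N : ℕ}
    (A : Matrix (Fin N) (Fin N) ℕ) (hA : NDS.IsTransitionMatrix A)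
    (V : Fin N → Set X) (hVne : ∀ i, (V i).Nonempty)
    (hVdist : ∀ i j, i ≠ j → 0 < NDS.setDist (V i) (V j))
    (hVbdd : ∀ i, Bornology.IsBounded (V i))
    (W : Fin N → ℕ → Set X) (hWne : ∀ i n, (W i n).Nonempty)
    (hWcpt : ∀ i n, IsCompact (W i n)) (hWV : ∀ i n, W i n ⊆ V i)
    (hequi : NDS.EquiCont (fun n (x : (⋃ (m) (i), W i m : Set X)) => f n x))
    (hexp : NDS.WeaklyCoupledExpanding f A W)
    (hlam : ∃ lam : ℝ, 1 < lam ∧ ∀ i n, ∀ x ∈ W i n, ∀ y ∈ W i n,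
      lam * dist x y ≤ dist (f n x) (f n y)) :
    (∃ Λ : ℕ → Set X,
      (∀ n, (Λ n).Nonempty ∧ IsCompact (Λ n) ∧ Λ n ⊆ ⋃ i, W i n) ∧
      (∀ n, f n '' Λ n = Λ (n + 1)) ∧
      NDS.EquiConjugate f Λ (fun _ => NDS.shift A) (fun _ => Set.univ) ∧
      (∀ _ : CompactSpace X, NDS.entropy f (Λ 0) = ((Real.log (NDS.rho A) : ℝ) : EReal))) ∧
    (NDS.IsIrreducible A → (∃ i₀, 2 ≤ ∑ j, A i₀ j) →
      (∃ δ : ℝ, 0 < δ ∧ NDS.LiYorkeChaotic f δ) ∧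
      NDS.DistributionallyChaotic f ∧
      NDS.StronglyLiYorkeChaotic f) := by
  obtain ⟨lam, hlam1, hexpand⟩ := hlam
  have hequi' : ∀ ε > 0, ∃ δ > 0, ∀ n, ∀ x ∈ ⋃ (m) (i), W i m, ∀ y ∈ ⋃ (m) (i), W i m,
      dist x y < δ → dist (f n x) (f n y) < ε := fun ε hε =>
    let ⟨δ, hδ, h⟩ := hequi ε hε
    ⟨δ, hδ, fun n x hx y hy hxy => h n ⟨x, hx⟩ ⟨y, hy⟩ hxy⟩
  have hWE : ∀ i n, W i n ⊆ ⋃ (m) (i), W i m := fun i n =>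
    subset_iUnion₂_of_subset n i Subset.rfl
  have hcont : ∀ i n, ContinuousOn (f n) (W i n) := fun i n => by
    rw [Metric.continuousOn_iff]
    intro y hy ε hε
    obtain ⟨δ, hδ, h⟩ := hequi' ε hε
    exact ⟨δ, hδ, fun x hx hxy => h n x (hWE i n hx) y (hWE i n hy) hxy⟩
  have hUbdd : Bornology.IsBounded (⋃ i, V i) := Bornology.isBounded_iUnion.2 hVbdd
  obtain ⟨D, hD⟩ := Metric.isBounded_iff.1 hUbdd
  have hWU : ∀ i n, W i n ⊆ ⋃ i, V i := fun i n => (hWV i n).trans (subset_iUnion V i)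
  have hD' : ∀ i n, ∀ x ∈ W i n, ∀ j, ∀ y ∈ W j n, dist x y ≤ D := fun i n x hx j y hy =>
    hD (hWU i n hx) (hWU j n hy)
  obtain ⟨δ₀, hδ₀, hsep₀⟩ : ∃ δ₀ > 0, ∀ i j n, ∀ x ∈ W i n, ∀ y ∈ W j n,
      dist x y < δ₀ → i = j := by
    -- There are finitely many pairs `i ≠ j`, so one positive `δ` lies below all the distances.
    have hev : ∀ᶠ δ in 𝓝[>] (0 : ℝ), ∀ i j, i ≠ j → δ < NDS.setDist (V i) (V j) := by
      simp only [eventually_all]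
      exact fun i j hij => nhdsWithin_le_nhds (eventually_lt_nhds (hVdist i j hij))
    obtain ⟨δ₀, h, hpos⟩ := (hev.and self_mem_nhdsWithin).exists
    refine ⟨δ₀, hpos, fun i j n x hx y hy hxy => ?_⟩
    by_contra hij
    exact ((h i j hij).trans_le (NDS.setDist_le_dist (hWV i n hx) (hWV j n hy))).not_gt hxy
  obtain ⟨G, hmem, hstep⟩ :=
    NDS.exists_coding hWne hexp.expand hWcpt hcont hlam1 hexpand hD'
  have hsmall : ∀ ε > 0, ∃ m : ℕ, ∀ n (s t : NDS.Subshift A), (∀ i < m, s.1 i = t.1 i) →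
      dist (G n s) (G n t) < ε := fun ε hε =>
    let ⟨m, hm⟩ := ((NDS.tendsto_mul_inv_pow hlam1 D).eventually_lt_const hε).exists
    ⟨m, fun n s t hst =>
      (NDS.dist_coding_le hmem hstep hlam1 hexpand hD' m n s t hst).trans_lt hm⟩
  have hsep := NDS.exists_separation hmem hstep hequi' hδ₀ hsep₀
  refine ⟨⟨fun n => range (G n), fun n => ⟨?_, ?_, ?_⟩, NDS.image_range_coding hA hstep,
    NDS.equiConjugate_coding hA hstep hsmall hsep, fun _ =>
      NDS.entropy_coding hA hstep hsmall hsep⟩, fun hirr hbranch => ?_⟩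
  · have := NDS.subshift_nonempty hA
    exact range_nonempty _
  · exact NDS.isCompact_range_of_agree fun ε hε =>
      let ⟨m, hm⟩ := hsmall ε hε
      ⟨m, hm n⟩
  · exact range_subset_iff.2 fun s => mem_iUnion.2 ⟨_, hmem n s⟩
  · obtain ⟨hdist, δ, hδ, S, hS, hscr, hbdd⟩ :=
      NDS.chaos_of_coding hA hirr hbranch hstep hsmall hsep fun s =>
        hUbdd.subset (range_subset_iff.2 fun n => by
          rw [NDS.iter_coding hstep]
          exact hWU _ _ (hmem _ _))
    exact ⟨⟨δ, hδ, S, hS, hscr⟩, hdist, δ, hδ, S, hS, hscr, hbdd⟩
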